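/- **Theorem 2 (Exact CP reformulation, Kronecker form).** Let $N\ge 1$, $n\ge 1$, let $d_0,\dots,d_N$ be nonnegative integers, $X\in\mathbb R^{d_0\times n}$, $Y\in\mathbb R^{d_N\times n}$, and put $d:=d_N+d_0$, $r:=\min_{0\le k\le N}d_k$, $$P_u=\begin{bmatrix}I_{d_N}\\0\end{bmatrix}\in\mathbb R^{d\times d_N},\qquad P_v=\begin{bmatrix}0\\I_{d_0}\end{bmatrix}\in\mathbb R^{d\times d_0}.$$ Let $\mathbb S^d$ be the space of real symmetric $d\times d$ matrices, $\mathbb S^d_+$ its positive semidefinite cone, $\mathbb V:=\mathbb R\oplus\mathbb S^d\oplus\mathbb S^d\oplus\mathbb S^d$ with elements $\omega=(\omega_0,\omega_1,\omega_2,\omega_3)$, $\bar{\mathbb K}:=\mathbb R_+\oplus\mathbb S^d_+\oplus\mathbb S^d_+\oplus\mathbb S^d_+$, and $\mathcal{CP}_{\bar{\mathbb K}}:=\operatorname{conv}\{\omega\otimes\omega:\omega\in\bar{\mathbb K}\}\subset\mathbb V\otimes\mathbb V$. For $\mathcal W\in\mathbb V\otimes\mathbb V$ let $\mathcal W_{ij}$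 ($0\le i,j\le 3$) be its blocks, i.e. the linear functions of $\mathcal W$ with $(\omega\otimes\eta)_{ij}=\omega_i\otimes\eta_j$; here $\otimes$ between matrices is the Kronecker product, so $\mathcal W_{ij}\in\mathbb R^{d^2\times d^2}$ for $i,j\ge1$, and $(\omega\otimes\eta)_{0j}=\omega_0\eta_j$. Let $\langle A,B\rangle=\sum_{i,j}A_{ij}B_{ij}$, let $E_{ij}$ be the standard basis matrices of $\mathbb R^{d\times d}$, let $\delta_{ij}$ be $1$ if $i=j$ and $0$ otherwise, let $\Delta=\sum_{i,j=1}^dE_{ij}\otimes E_{ij}$, and for $M\in\mathbb R^{d^2\times d^2}$ let $\mathcal R(M)_{(i,k),(j,\ell)}=M_{(i,j),(k,\ell)}$. Then the deep linear training problem $$\min_{W_k\in\mathbb R^{d_k\times d_{k-1}},\;k=1,\dots,N}\ \frac1{2n}\|W_N\cdots W_1X-Y\|_F^2$$ and the program $$\begin{aligned}\min_{\mathcal W\in\mathcal{CP}_{\bar{\mathbb K}}}\quad&\frac1{2n}\Big(\langle\mathcal R(P_vXX^\top P_v^\top\otimes P_uP_u^\top),\mathcal W_{11}\rangle-2\langle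 P_uYX^\top P_v^\top,\mathcal W_{01}\rangle+\|Y\|_F^2\Big)\\ \text{s.t.}\quad&\mathcal W_{00}=1,\qquad\operatorname{tr}(\mathcal W_{02})=r,\qquad\operatorname{tr}(\mathcal W_{22})=r^2,\\ &\langle E_{ij},\mathcal W_{02}+\mathcal W_{03}\rangle=\delta_{ij}\quad\text{for all }i,j,\\ &\langle E_{ij}\otimes E_{ij},\mathcal W_{22}+\mathcal W_{23}+\mathcal W_{32}+\mathcal W_{33}\rangle=\delta_{ij}\quad\text{for all }i,j,\\ &\operatorname{tr}(\mathcal W_{01})-\langle\Delta,\mathcal W_{12}\rangle\le0\end{aligned}$$ have the same optimal value, and both minima are attained. The second program is convex: its feasible set is convex, its objective is a linear function of $\mathcal W$ plus a constant, and its constraints other than $\mathcal W\in\mathcal{CP}_{\bar{\mathbb K}}$ are finitely many linear equations and one linear inequality in $\mathcal W$. Moreover $\langle\Delta,A\otimes B\rangle=\langle A,B\rangle$ for all $A,B\in\mathbb R^{d\times d}$. -/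

import Mathlib

open scoped TensorProduct Kronecker Matrix

noncomputable section

namespace DeepLinearCP

/-! ### The training problem of a deep linear network -/

/-- The product `W_N * W_{N-1} * ⋯ * W_1` of the layer matrices, where the layer with index
`k : Fin N` (layer number `k + 1`) maps `ℝ^{d k}` to `ℝ^{d (k+1)}`. -/
def layerProd : {N : ℕ} → (d : Fin (N + 1) → ℕ) →
    ((k : Fin N) → Matrix (Fin (d k.succ)) (Fin (d k.castSucc)) ℝ) →
    Matrix (Fin (d (Fin.last N))) (Fin (d 0)) ℝ
  | 0, d, _ => (1 : Matrix (Fin (d 0)) (Fin (d 0)) ℝ)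
  | N + 1, d, W =>
      W (Fin.last N) * layerProd (fun k : Fin (N + 1) => d k.castSucc) (fun k => W k.castSucc)

open scoped Matrix.Norms.Frobenius in
/-- The squared Frobenius norm `‖A‖_F²`. -/
def frobSq {m n : Type*} [Fintype m] [Fintype n] (A : Matrix m n ℝ) : ℝ := ‖A‖ ^ 2

/-- The training loss `1/(2n) ‖W_N ⋯ W_1 X - Y‖_F²`. -/
def deepLoss {N n : ℕ} (d : Fin (N + 1) → ℕ)
    (X : Matrix (Fin (d 0)) (Fin n) ℝ) (Y : Matrix (Fin (d (Fin.last N))) (Fin n) ℝ)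
    (W : (k : Fin N) → Matrix (Fin (d k.succ)) (Fin (d k.castSucc)) ℝ) : ℝ :=
  1 / (2 * (n : ℝ)) * frobSq (layerProd d W * X - Y)

/-- `r = min_k d_k`, over all widths `d_0, …, d_N`. -/
def minWidth {N : ℕ} (d : Fin (N + 1) → ℕ) : ℕ :=
  Finset.univ.inf' Finset.univ_nonempty d

/-! ### Matrices -/

/-- The trace inner product `⟨A, B⟩ = ∑_{i,j} A_{ij} B_{ij}`. -/
def frobInner {m n : Type*} [Fintype m] [Fintype n] (A B : Matrix m n ℝ) : ℝ :=
  ∑ i, ∑ j, A i j * B i j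

/-- `P_u = [I; 0]`; the `d = p + q` coordinates are indexed by `Fin p ⊕ Fin q`. -/
def selU (p q : ℕ) : Matrix (Fin p ⊕ Fin q) (Fin p) ℝ := Matrix.fromRows 1 0

/-- `P_v = [0; I]`. -/
def selV (p q : ℕ) : Matrix (Fin p ⊕ Fin q) (Fin q) ℝ := Matrix.fromRows 0 1

/-- The reshuffling `R(M)_{(i,k),(j,l)} = M_{(i,j),(k,l)}`. -/
def reshuffle {ι : Type*} (M : Matrix (ι × ι) (ι × ι) ℝ) : Matrix (ι × ι) (ι × ι) ℝ :=
  Matrix.of fun a b => M (a.1, b.1) (a.2, b.2)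

/-- The standard basis matrix `E_{ij}`. -/
def stdBasis {ι : Type*} [DecidableEq ι] (i j : ι) : Matrix ι ι ℝ := Matrix.single i j 1

/-- The diagonal contraction `Δ = ∑_{i,j} E_{ij} ⊗ E_{ij}`. -/
def diagContraction (ι : Type*) [Fintype ι] [DecidableEq ι] : Matrix (ι × ι) (ι × ι) ℝ :=
  ∑ i : ι, ∑ j : ι, stdBasis i j ⊗ₖ stdBasis i j

/-! ### Generalized completely positive cones -/

/-- The `K`-completely positive cone `conv {z ⊗ z : z ∈ K}`. -/
def cpCone {V : Type*} [AddCommGroup V] [Module ℝ V] (K : Set V) : Set (V ⊗[ℝ] V) :=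
  convexHull ℝ ((fun z : V => z ⊗ₜ[ℝ] z) '' K)

/-- The space `𝕊` of real symmetric matrices. -/
abbrev SymMat (ι : Type*) [Fintype ι] : Type _ := selfAdjoint.submodule ℝ (Matrix ι ι ℝ)

/-- The space `ℝ ⊕ 𝕊 ⊕ 𝕊 ⊕ 𝕊`, with elements `ω = (ω₀, ω₁, ω₂, ω₃)`. -/
abbrev BaseSpace (ι : Type*) [Fintype ι] : Type _ := ℝ × SymMat ι × SymMat ι × SymMat ι

/-- The cone `ℝ₊ ⊕ 𝕊₊ ⊕ 𝕊₊ ⊕ 𝕊₊`. -/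
def baseCone (ι : Type*) [Fintype ι] : Set (BaseSpace ι) :=
  {ω | 0 ≤ ω.1 ∧ (ω.2.1 : Matrix ι ι ℝ).PosSemidef ∧
    (ω.2.2.1 : Matrix ι ι ℝ).PosSemidef ∧ (ω.2.2.2 : Matrix ι ι ℝ).PosSemidef}

section Blocks

variable {ι : Type*} [Fintype ι]

/-- The component `ω ↦ ω₀`. -/
def comp0 : BaseSpace ι →ₗ[ℝ] ℝ := LinearMap.fst ℝ _ _

/-- The component `ω ↦ ω₁`, as a matrix. -/
def comp1 : BaseSpace ι →ₗ[ℝ] Matrix ι ι ℝ :=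
  (selfAdjoint.submodule ℝ (Matrix ι ι ℝ)).subtype ∘ₗ LinearMap.fst ℝ _ _ ∘ₗ LinearMap.snd ℝ _ _

/-- The component `ω ↦ ω₂`, as a matrix. -/
def comp2 : BaseSpace ι →ₗ[ℝ] Matrix ι ι ℝ :=
  (selfAdjoint.submodule ℝ (Matrix ι ι ℝ)).subtype ∘ₗ LinearMap.fst ℝ _ _ ∘ₗ
    LinearMap.snd ℝ _ _ ∘ₗ LinearMap.snd ℝ _ _

/-- The component `ω ↦ ω₃`, as a matrix. -/
def comp3 : BaseSpace ι →ₗ[ℝ] Matrix ι ι ℝ :=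
  (selfAdjoint.submodule ℝ (Matrix ι ι ℝ)).subtype ∘ₗ LinearMap.snd ℝ _ _ ∘ₗ
    LinearMap.snd ℝ _ _ ∘ₗ LinearMap.snd ℝ _ _

/-- The scalar block `𝒲₀₀`; on tensors it is `ω ⊗ η ↦ ω₀ η₀`. -/
def block00 : BaseSpace ι ⊗[ℝ] BaseSpace ι →ₗ[ℝ] ℝ :=
  TensorProduct.lift ((LinearMap.mul ℝ ℝ).compl₁₂ comp0 comp0)

/-- The block `𝒲₀ⱼ`, where `q` is the `j`-th component; on tensors it is `ω ⊗ η ↦ ω₀ ηⱼ`. -/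
def block0 (q : BaseSpace ι →ₗ[ℝ] Matrix ι ι ℝ) :
    BaseSpace ι ⊗[ℝ] BaseSpace ι →ₗ[ℝ] Matrix ι ι ℝ :=
  TensorProduct.lift ((LinearMap.lsmul ℝ (Matrix ι ι ℝ)).compl₁₂ comp0 q)

/-- The block `𝒲ᵢⱼ`, where `p` and `q` are the `i`-th and `j`-th components; on tensors it is
the Kronecker product `ω ⊗ η ↦ ωᵢ ⊗ ηⱼ`. -/
def block (p q : BaseSpace ι →ₗ[ℝ] Matrix ι ι ℝ) :
    BaseSpace ι ⊗[ℝ] BaseSpace ι →ₗ[ℝ] Matrix (ι × ι) (ι × ι) ℝ :=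
  TensorProduct.lift ((Matrix.kroneckerBilinear (R := ℝ) (α := ℝ)).compl₁₂ p q)

/-- The affine constraints of the lifted program, for the trace parameter `r`. -/
structure LinearConstraints [DecidableEq ι] (r : ℕ) (𝒲 : BaseSpace ι ⊗[ℝ] BaseSpace ι) :
    Prop where
  corner : block00 𝒲 = 1
  trace_one : (block0 comp2 𝒲).trace = r
  trace_two : (block comp2 comp2 𝒲).trace = (r : ℝ) ^ 2
  sum_one : ∀ i j : ι,
    frobInner (stdBasis i j) (block0 comp2 𝒲 + block0 comp3 𝒲) = if i = j then 1 else 0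
  sum_two : ∀ i j : ι,
    frobInner (stdBasis i j ⊗ₖ stdBasis i j)
      (block comp2 comp2 𝒲 + block comp2 comp3 𝒲 + block comp3 comp2 𝒲 + block comp3 comp3 𝒲)
        = if i = j then 1 else 0
  complementarity :
    (block0 comp1 𝒲).trace - frobInner (diagContraction ι) (block comp1 comp2 𝒲) ≤ 0

/-- The feasible set of the lifted program. -/
def liftedFeasible (ι : Type*) [Fintype ι] [DecidableEq ι] (r : ℕ) :
    Set (BaseSpace ι ⊗[ℝ] BaseSpace ι) :=
  {𝒲 | LinearConstraints r 𝒲} ∩ cpCone (baseCone ι)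

end Blocks

/-- The objective of the lifted program. -/
def liftedObjective {p q n : ℕ} (X : Matrix (Fin q) (Fin n) ℝ) (Y : Matrix (Fin p) (Fin n) ℝ)
    (𝒲 : BaseSpace (Fin p ⊕ Fin q) ⊗[ℝ] BaseSpace (Fin p ⊕ Fin q)) : ℝ :=
  1 / (2 * (n : ℝ)) *
    (frobInner (reshuffle ((selV p q * X * Xᵀ * (selV p q)ᵀ) ⊗ₖ (selU p q * (selU p q)ᵀ)))
        (block comp1 comp1 𝒲)
      - 2 * frobInner (selU p q * Y * Xᵀ * (selV p q)ᵀ) (block0 comp1 𝒲)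
      + frobSq Y)

end DeepLinearCP

end

/-!
A linear network with widths `d 0, …, d N` realizes exactly the matrices of rank at most
`r = min d k` (`range_layerProd`): the rank cannot exceed any width, and a rank factorization can
be threaded through the layers. Training is therefore reduced-rank regression of `Y` on `X`, which
has a minimizer because the matrices `Z * X` with `rank Z ≤ r` form a closed set
(`exists_isMinOn_rank_le`).

On the lifted side, decompose a feasible point as `∑ i, w i • (z i ⊗ z i)` with `w i ≥ 0` and
`z = (a, U, V, S)` in the cone. The corner constraint says that the `a i` have unit weighted length,
and the paired linear and quadratic constraints are equality cases of the Cauchy–Schwarz inequality.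
So each term satisfies `tr V = r a` and `V + S = a I`. The complementarity inequality
then reads `∑ w ⟨U, S⟩ ≤ 0`, and since the summands are nonnegative, each `⟨U, S⟩` is zero and hence
`U * S = 0` (`isComplementary_of_linearConstraints`). For `a > 0` the eigenvalues of `S / a` lie in
`[0, 1]`, so `rank U ≤ dim ker S ≤ tr V / a = r` (`IsComplementary.rank_le`).

The objective is the weighted sum of `‖Z X - a Y‖² / (2n)` over the terms, where `Z` is the
off-diagonal block of `U` (`lifted_quadratic_eq`). By homogeneity a term with `a > 0` is at least
`a²` times the optimal training loss, and a term with `a = 0` is nonnegative. Summing up gives the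
lower bound (`le_liftedObjective`). Conversely, a matrix `Z = A * B` of rank at most `r` is the
off-diagonal block of the Gram matrix `U` of the rows of `[A; Bᵀ]`. With `V` a projection of rank
exactly `r` whose range contains that of `U`, the tensor square of `(1, U, V, I - V)` is feasible
and has the loss of `Z` as its objective (`exists_liftedFeasible_of_rank_le`).
-/

open scoped TensorProduct Kronecker Matrix

noncomputable section

namespace DeepLinearCP

/-! ### Rank factorizations and products of layers -/

/-- The column space embeds into `ℝ^r`; `A` is a left inverse of the embedding and `B` is
`Z` followed by the embedding. -/
theorem exists_eq_mul_of_rank_le {p q r : ℕ} (Z : Matrix (Fin p) (Fin q) ℝ) (h : Z.rank ≤ r) :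
    ∃ (A : Matrix (Fin p) (Fin r) ℝ) (B : Matrix (Fin r) (Fin q) ℝ), Z = A * B := by
  obtain ⟨f, hf⟩ := (finrank_le_iff_exists_linearMap (R := ℝ)
    (M := LinearMap.range Z.mulVecLin) (M' := Fin r → ℝ)).1 (by
      rw [Module.finrank_fin_fun]; exact h)
  obtain ⟨g, hg⟩ := LinearMap.exists_leftInverse_of_injective f (LinearMap.ker_eq_bot.2 hf)
  refine ⟨LinearMap.toMatrix' ((LinearMap.range Z.mulVecLin).subtype ∘ₗ g),
    LinearMap.toMatrix' (f ∘ₗ Z.mulVecLin.rangeRestrict), ?_⟩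
  rw [← LinearMap.toMatrix'_comp, LinearMap.comp_assoc, ← LinearMap.comp_assoc _ f g, hg,
    LinearMap.id_comp]
  exact (LinearMap.toMatrix'_toLin' Z).symm

theorem rank_layerProd_le {N : ℕ} (d : Fin (N + 1) → ℕ)
    (W : (k : Fin N) → Matrix (Fin (d k.succ)) (Fin (d k.castSucc)) ℝ) (k : Fin (N + 1)) :
    (layerProd d W).rank ≤ d k := by
  induction N with
  | zero =>
    obtain rfl : k = 0 := Fin.fin_one_eq_zero k
    exact Matrix.rank_le_width _
  | succ N ih =>
    induction k using Fin.lastCases with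
    | last => exact Matrix.rank_le_height _
    | cast k =>
      exact (Matrix.rank_mul_le_right _ _).trans (ih (fun k => d k.castSucc) _ k)

/-- The inclusion of `ℝ^r` into `ℝ^m` as the first `r` coordinates, meaningful for `r ≤ m`. -/
def coordInclusion (m r : ℕ) : Matrix (Fin m) (Fin r) ℝ :=
  Matrix.of fun i j => if (i : ℕ) = j then 1 else 0

theorem mul_coordInclusion_cancel {m r p q : ℕ} (h : r ≤ m) (G : Matrix (Fin p) (Fin r) ℝ)
    (B : Matrix (Fin r) (Fin q) ℝ) :
    G * (coordInclusion m r)ᵀ * (coordInclusion m r * B) = G * B := by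
  suffices hJ : (coordInclusion m r)ᵀ * coordInclusion m r = 1 by
    rw [Matrix.mul_assoc, ← Matrix.mul_assoc _ _ B, hJ, Matrix.one_mul]
  ext i j
  rw [Matrix.mul_apply, Finset.sum_eq_single (Fin.castLE h i)]
  · simp [coordInclusion, Matrix.one_apply, Fin.ext_iff]
  · intro b _ hb
    have : (b : ℕ) ≠ i := fun hbi => hb (Fin.ext hbi)
    simp [coordInclusion, this]
  · simp

/-- A product `G * B` through `r` coordinates is realized by at least one layer when every width
is at least `r`: all layers but the first and last merely carry the `r` coordinates along. -/
theorem exists_layerProd_eq_mul {N r : ℕ} (d : Fin (N + 2) → ℕ) (hd : ∀ k, r ≤ d k)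
    (G : Matrix (Fin (d (Fin.last (N + 1)))) (Fin r) ℝ) (B : Matrix (Fin r) (Fin (d 0)) ℝ) :
    ∃ W, layerProd d W = G * B := by
  induction N with
  | zero =>
    refine ⟨fun k => match k with | 0 => G * B, ?_⟩
    exact Matrix.mul_one _
  | succ N ih =>
    obtain ⟨W, hW⟩ := ih (fun k => d k.castSucc) (fun k => hd _) (coordInclusion _ r) B
    refine ⟨Fin.lastCases (G * (coordInclusion (d (Fin.last (N + 1)).castSucc) r)ᵀ) W, ?_⟩
    rw [layerProd]
    simp only [Fin.lastCases_last, Fin.lastCases_castSucc]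
    rw [hW]
    exact mul_coordInclusion_cancel (hd _) G B

/-- The end-to-end matrices of the network are exactly those of rank at most the minimal width. -/
theorem range_layerProd {N : ℕ} (hN : 1 ≤ N) (d : Fin (N + 1) → ℕ) :
    Set.range (layerProd d) = {Z | Z.rank ≤ minWidth d} := by
  ext Z
  constructor
  · rintro ⟨W, rfl⟩
    exact Finset.le_inf' _ _ fun k _ => rank_layerProd_le d W k
  · intro hZ
    obtain ⟨A, B, rfl⟩ := exists_eq_mul_of_rank_le Z hZ
    obtain ⟨M, rfl⟩ := Nat.exists_eq_add_of_le' hN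
    exact exists_layerProd_eq_mul d (fun k => Finset.inf'_le _ (Finset.mem_univ k)) A B

/-! ### The trace inner product -/

theorem frobInner_eq_trace {m n : Type*} [Fintype m] [Fintype n] (A B : Matrix m n ℝ) :
    frobInner A B = (Aᵀ * B).trace := by
  simp only [frobInner, Matrix.trace, Matrix.diag, Matrix.mul_apply, Matrix.transpose_apply]
  exact Finset.sum_comm

/-- The linear functional `⟨A, ·⟩`. -/
def frobInnerLeft {m n : Type*} [Fintype m] [Fintype n] (A : Matrix m n ℝ) :
    Matrix m n ℝ →ₗ[ℝ] ℝ where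
  toFun := frobInner A
  map_add' B C := by simp [frobInner, mul_add, Finset.sum_add_distrib]
  map_smul' c B := by simp [frobInner, Finset.mul_sum, mul_left_comm]

theorem frobInnerLeft_apply {m n : Type*} [Fintype m] [Fintype n] (A B : Matrix m n ℝ) :
    frobInnerLeft A B = frobInner A B := rfl

theorem frobSq_eq_frobInner {m n : Type*} [Fintype m] [Fintype n] (A : Matrix m n ℝ) :
    frobSq A = frobInner A A := by
  have h : 0 ≤ ∑ i, ∑ j, ‖A i j‖ ^ (2 : ℝ) := by positivity
  rw [frobSq, Matrix.frobenius_norm_def, ← Real.sqrt_eq_rpow, Real.sq_sqrt h]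
  simp [frobInner, sq]

theorem frobSq_nonneg {m n : Type*} [Fintype m] [Fintype n] (A : Matrix m n ℝ) :
    0 ≤ frobSq A := sq_nonneg _

theorem frobSq_smul {m n : Type*} [Fintype m] [Fintype n] (a : ℝ) (A : Matrix m n ℝ) :
    frobSq (a • A) = a ^ 2 * frobSq A := by
  simp only [frobSq_eq_frobInner, frobInner, Matrix.smul_apply, smul_eq_mul, Finset.mul_sum]
  exact Finset.sum_congr rfl fun i _ => Finset.sum_congr rfl fun j _ => by ring

theorem frobSq_sub_smul {m n : Type*} [Fintype m] [Fintype n] (a : ℝ) (A B : Matrix m n ℝ) :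
    frobSq (A - a • B) = frobSq A - 2 * (a * frobInner B A) + a ^ 2 * frobSq B := by
  simp only [frobSq_eq_frobInner, frobInner, Matrix.smul_apply, Matrix.sub_apply, smul_eq_mul,
    Finset.mul_sum, ← Finset.sum_sub_distrib, ← Finset.sum_add_distrib]
  exact Finset.sum_congr rfl fun i _ => Finset.sum_congr rfl fun j _ => by ring

section
variable {ι : Type*} [Fintype ι] [DecidableEq ι]

theorem frobInner_stdBasis (i j : ι) (A : Matrix ι ι ℝ) :
    frobInner (stdBasis i j) A = A i j := by
  simp [frobInner_eq_trace, stdBasis, Matrix.trace_single_mul]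

theorem frobInner_stdBasis_kronecker (i j : ι) (M : Matrix (ι × ι) (ι × ι) ℝ) :
    frobInner (stdBasis i j ⊗ₖ stdBasis i j) M = M (i, i) (j, j) := by
  rw [stdBasis, Matrix.single_kronecker_single, mul_one, frobInner_eq_trace]
  simp [Matrix.trace_single_mul]

theorem frobInner_diagContraction (A B : Matrix ι ι ℝ) :
    frobInner (diagContraction ι) (A ⊗ₖ B) = frobInner A B := by
  rw [frobInner_eq_trace, diagContraction]
  simp only [Matrix.transpose_sum, Matrix.sum_mul, Matrix.trace_sum, ← frobInner_eq_trace,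
    frobInner_stdBasis_kronecker]
  rfl

end

theorem frobInner_reshuffle {ι : Type*} [Fintype ι] (A B U : Matrix ι ι ℝ) :
    frobInner (reshuffle (A ⊗ₖ B)) (U ⊗ₖ U) = (Aᵀ * U * B * Uᵀ).trace := by
  simp only [frobInner, reshuffle, Fintype.sum_prod_type, Matrix.trace, Matrix.diag,
    Matrix.mul_apply, Matrix.transpose_apply, Matrix.of_apply, Matrix.kroneckerMap_apply,
    Finset.sum_mul]
  rw [Finset.sum_comm]
  refine Finset.sum_congr rfl fun k _ => ?_
  rw [Finset.sum_comm_cycle]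
  refine Finset.sum_congr rfl fun l _ => ?_
  rw [Finset.sum_comm]
  exact Finset.sum_congr rfl fun j _ => Finset.sum_congr rfl fun i _ => by ring

/-- The quadratic form of the lifted objective at `(a, U)` is the squared residual of the
off-diagonal block of `U`. -/
theorem lifted_quadratic_eq {p q n : ℕ} (X : Matrix (Fin q) (Fin n) ℝ)
    (Y : Matrix (Fin p) (Fin n) ℝ) (a : ℝ) {U : Matrix (Fin p ⊕ Fin q) (Fin p ⊕ Fin q) ℝ}
    (hU : Uᵀ = U) :
    frobInner (reshuffle ((selV p q * X * Xᵀ * (selV p q)ᵀ) ⊗ₖ (selU p q * (selU p q)ᵀ))) (U ⊗ₖ U)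
      - 2 * frobInner (selU p q * Y * Xᵀ * (selV p q)ᵀ) (a • U) + a ^ 2 * frobSq Y
      = frobSq ((selU p q)ᵀ * U * selV p q * X - a • Y) := by
  rw [frobSq_sub_smul, frobInner_reshuffle, ← frobInnerLeft_apply _ (a • U), map_smul,
    frobInnerLeft_apply, smul_eq_mul, frobSq_eq_frobInner (_ * X)]
  congr 4
  · rw [frobInner_eq_trace]
    simp only [Matrix.transpose_mul, Matrix.transpose_transpose, hU, Matrix.mul_assoc]
    -- cyclicity of the trace moves the leading factor `P_v * X` to the end
    rw [← Matrix.mul_assoc (selV p q) X, Matrix.trace_mul_comm]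
    simp only [Matrix.mul_assoc]
  · rw [frobInner_eq_trace, frobInner_eq_trace]
    simp only [Matrix.transpose_mul, Matrix.transpose_transpose, Matrix.mul_assoc]
    rw [← Matrix.mul_assoc (selV p q) X, Matrix.trace_mul_comm]
    simp only [Matrix.mul_assoc]

/-! ### Attainment in reduced-rank regression -/

open scoped Matrix.Norms.Frobenius in
theorem isClosed_setOf_rank_le (p q r : ℕ) :
    IsClosed {M : Matrix (Fin p) (Fin q) ℝ | M.rank ≤ r} := by
  let Φ : Matrix (Fin p) (Fin q) ℝ →ₗ[ℝ] ((Fin q → ℝ) →L[ℝ] (Fin p → ℝ)) :=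
    LinearMap.toContinuousLinearMap.toLinearMap ∘ₗ Matrix.toLin'.toLinearMap
  have hΦ : Continuous Φ := Φ.continuous_of_finiteDimensional
  have hopen := (isOpen_setOfPred_nat_le_rank (𝕜 := ℝ) (E := Fin q → ℝ) (F := Fin p → ℝ)
    (r + 1)).preimage hΦ
  convert hopen.isClosed_compl using 1
  ext M
  have hM : ((M.rank : ℕ) : Cardinal) = LinearMap.rank (M.mulVecLin) := Module.finrank_eq_rank _ _
  change M.rank ≤ r ↔ ¬ ((r + 1 : ℕ) : Cardinal) ≤ LinearMap.rank (M.mulVecLin)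
  rw [← hM, Nat.cast_le]
  omega

/-- A matrix of rank at most `r` in the range of right multiplication by `X` is `Z * X` with `Z`
of rank at most `r`: compose a preimage with a projection onto the column space. -/
theorem exists_mul_eq_of_rank_le {p q n r : ℕ} {X : Matrix (Fin q) (Fin n) ℝ}
    {C : Matrix (Fin p) (Fin q) ℝ} (h : (C * X).rank ≤ r) :
    ∃ Z : Matrix (Fin p) (Fin q) ℝ, Z.rank ≤ r ∧ Z * X = C * X := by
  obtain ⟨g, hg⟩ := (LinearMap.range (C * X).mulVecLin).subtype.exists_leftInverse_of_injective
    (Submodule.ker_subtype _)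
  let π := (LinearMap.range (C * X).mulVecLin).subtype ∘ₗ g
  have hπ : (LinearMap.toMatrix' π).mulVecLin = π := Matrix.toLin'_toMatrix' π
  refine ⟨LinearMap.toMatrix' π * C, (Matrix.rank_mul_le_left _ _).trans (le_trans ?_ h), ?_⟩
  · rw [Matrix.rank, hπ]
    refine Submodule.finrank_mono ?_
    rintro _ ⟨x, rfl⟩
    exact (g x).2
  · rw [Matrix.mul_assoc]
    apply Matrix.toLin'.injective
    rw [Matrix.toLin'_mul, Matrix.toLin'_toMatrix']
    refine LinearMap.ext fun x => ?_
    have := LinearMap.congr_fun hg ⟨(C * X).mulVecLin x, x, rfl⟩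
    exact congrArg Subtype.val this

open scoped Matrix.Norms.Frobenius in
/-- The minimizing `Z` need not come from a bounded set when `X` lacks full row rank, so the
minimum is taken over the products `Z * X` instead: they form the closed set of matrices of rank
at most `r` in the range of right multiplication by `X`. -/
theorem exists_isMinOn_rank_le {p q n r : ℕ} (X : Matrix (Fin q) (Fin n) ℝ)
    (Y : Matrix (Fin p) (Fin n) ℝ) :
    ∃ Z₀ : Matrix (Fin p) (Fin q) ℝ, Z₀.rank ≤ r ∧
      ∀ Z : Matrix (Fin p) (Fin q) ℝ, Z.rank ≤ r → frobSq (Z₀ * X - Y) ≤ frobSq (Z * X - Y) := by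
  let R : Matrix (Fin p) (Fin q) ℝ →ₗ[ℝ] Matrix (Fin p) (Fin n) ℝ :=
    mulRightLinearMap (Fin p) ℝ X
  let S : Set (Matrix (Fin p) (Fin n) ℝ) := {M | M.rank ≤ r} ∩ (LinearMap.range R : Set _)
  have hclosed : IsClosed S :=
    (isClosed_setOf_rank_le p n r).inter (Submodule.closed_of_finiteDimensional _)
  have hne : S.Nonempty := ⟨0, by simp, zero_mem _⟩
  have : ProperSpace (Matrix (Fin p) (Fin n) ℝ) := FiniteDimensional.proper ℝ _
  obtain ⟨M, ⟨hMr, C, hC⟩, hMY⟩ := hclosed.exists_infDist_eq_dist hne Y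
  replace hC : C * X = M := hC
  subst hC
  obtain ⟨Z₀, hZ₀, hZ₀X⟩ := exists_mul_eq_of_rank_le hMr
  refine ⟨Z₀, hZ₀, fun Z hZ => ?_⟩
  rw [hZ₀X]
  have hZS : Z * X ∈ S := ⟨(Matrix.rank_mul_le_left _ _).trans hZ, Z, rfl⟩
  have hdist := Metric.infDist_le_dist_of_mem (x := Y) hZS
  rw [hMY, dist_comm, dist_comm Y, dist_eq_norm, dist_eq_norm] at hdist
  exact pow_le_pow_left₀ (norm_nonneg _) hdist 2

/-! ### Positive semidefinite matrices -/

section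
variable {ι : Type*} [Fintype ι]

open scoped MatrixOrder in
/-- For `U = BᵀB` and `S = CᵀC` the inner product is the squared Frobenius norm of `B * Cᵀ`. -/
theorem frobInner_nonneg_and_mul_eq_zero {U S : Matrix ι ι ℝ} (hU : U.PosSemidef)
    (hS : S.PosSemidef) :
    0 ≤ frobInner U S ∧ (frobInner U S = 0 → U * S = 0) := by
  classical
  obtain ⟨B, rfl⟩ := CStarAlgebra.nonneg_iff_eq_star_mul_self.1 hU.nonneg
  obtain ⟨C, rfl⟩ := CStarAlgebra.nonneg_iff_eq_star_mul_self.1 hS.nonneg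
  simp only [Matrix.star_eq_conjTranspose] at *
  have key : frobInner (Bᴴ * B) (Cᴴ * C) = ((B * Cᴴ)ᴴ * (B * Cᴴ)).trace := by
    rw [frobInner_eq_trace, ← Matrix.conjTranspose_eq_transpose_of_trivial]
    simp only [Matrix.conjTranspose_mul, Matrix.conjTranspose_conjTranspose]
    rw [← Matrix.mul_assoc, Matrix.trace_mul_comm]
    simp only [Matrix.mul_assoc]
  rw [key]
  refine ⟨(Matrix.posSemidef_conjTranspose_mul_self _).trace_nonneg, fun h => ?_⟩
  rw [Matrix.mul_assoc, ← Matrix.mul_assoc B,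
    Matrix.trace_conjTranspose_mul_self_eq_zero_iff.1 h, Matrix.zero_mul, Matrix.mul_zero]

variable [DecidableEq ι]

theorem eigenvalues_le_one {S : Matrix ι ι ℝ} (hS : S.IsHermitian) (h : (1 - S).PosSemidef)
    (i : ι) : hS.eigenvalues i ≤ 1 := by
  have hv := h.dotProduct_mulVec_nonneg (hS.eigenvectorBasis i).ofLp
  have hone : star (hS.eigenvectorBasis i).ofLp ⬝ᵥ (hS.eigenvectorBasis i).ofLp = 1 := by
    rw [dotProduct_comm, ← EuclideanSpace.inner_eq_star_dotProduct, real_inner_self_eq_norm_sq,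
      hS.eigenvectorBasis.norm_eq_one, one_pow]
  rw [Matrix.sub_mulVec, Matrix.one_mulVec, hS.mulVec_eigenvectorBasis, dotProduct_sub,
    dotProduct_smul, hone] at hv
  simpa using hv

/-- The trace is the sum of the eigenvalues, which lie in `[0, 1]`, and the rank counts the nonzero
ones. -/
theorem trace_le_rank {S : Matrix ι ι ℝ} (hS : S.PosSemidef) (h : (1 - S).PosSemidef) :
    S.trace ≤ S.rank := by
  rw [hS.1.trace_eq_sum_eigenvalues, hS.1.rank_eq_card_non_zero_eigs, Fintype.card_subtype,
    Finset.card_eq_sum_ones, Finset.sum_filter, Nat.cast_sum]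
  refine Finset.sum_le_sum fun i _ => ?_
  split_ifs with hi
  · simpa using eigenvalues_le_one hS.1 h i
  · simp [not_not.1 hi]

/-- If `V` and `S = 1 - V` are positive semidefinite, then the rank of a matrix supported on the
fixed space of `V` is at most the trace of `V`. -/
theorem rank_le_of_mul_eq_zero {U V S : Matrix ι ι ℝ} {r : ℕ} (hV : V.PosSemidef)
    (hS : S.PosSemidef) (hVS : V + S = 1) (hr : V.trace = r) (hUS : U * S = 0) : U.rank ≤ r := by
  have h1 := trace_le_rank hS (by rwa [← hVS, add_sub_cancel_right])
  have h2 : (U.rank : ℝ) + S.rank ≤ Fintype.card ι := by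
    exact_mod_cast Matrix.rank_add_rank_le_card_of_mul_eq_zero hUS
  have h3 := congrArg Matrix.trace hVS
  rw [Matrix.trace_add, Matrix.trace_one, hr] at h3
  exact_mod_cast (by linarith : (U.rank : ℝ) ≤ r)

/-- The range of a Hermitian matrix of rank at most `r` lies in the range of an orthogonal
projection of rank exactly `r`, namely the one onto the span of `r` eigenvectors. -/
theorem exists_projection_of_rank_le {U : Matrix ι ι ℝ} (hU : U.IsHermitian) {r : ℕ}
    (hr : U.rank ≤ r) (hr' : r ≤ Fintype.card ι) :
    ∃ V : Matrix ι ι ℝ, V.PosSemidef ∧ (1 - V).PosSemidef ∧ V.trace = r ∧ U * V = U := by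
  obtain ⟨T, hT, hTr⟩ := Finset.exists_superset_card_eq (n := r)
    (s := Finset.univ.filter fun i => hU.eigenvalues i ≠ 0)
    (by rwa [hU.rank_eq_card_non_zero_eigs, Fintype.card_subtype] at hr) hr'
  let O : Matrix ι ι ℝ := ↑hU.eigenvectorUnitary
  have hO : Oᴴ * O = 1 := Unitary.coe_star_mul_self hU.eigenvectorUnitary
  have hO' : O * Oᴴ = 1 := Unitary.coe_mul_star_self hU.eigenvectorUnitary
  let D : Matrix ι ι ℝ := Matrix.diagonal fun i => if i ∈ T then 1 else 0
  have hspec : U = O * Matrix.diagonal hU.eigenvalues * Oᴴ := hU.spectral_theorem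
  have hD : D.PosSemidef := Matrix.PosSemidef.diagonal fun i => by
    dsimp only; split_ifs <;> simp
  have hD' : (1 - D).PosSemidef := by
    rw [← Matrix.diagonal_one, Matrix.diagonal_sub]
    refine Matrix.PosSemidef.diagonal fun i => ?_
    dsimp only; split_ifs <;> simp
  refine ⟨O * D * Oᴴ, hD.mul_mul_conjTranspose_same O, ?_, ?_, ?_⟩
  · have h := hD'.mul_mul_conjTranspose_same O
    rwa [Matrix.mul_sub, Matrix.sub_mul, Matrix.mul_one, hO'] at h
  · rw [Matrix.trace_mul_comm, ← Matrix.mul_assoc, hO, Matrix.one_mul, Matrix.trace_diagonal]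
    simp [hTr]
  · have hdiag : Matrix.diagonal hU.eigenvalues * D = Matrix.diagonal hU.eigenvalues := by
      rw [Matrix.diagonal_mul_diagonal]
      congr 1
      ext i
      split_ifs with hi
      · exact mul_one _
      · by_contra hne
        exact hi (hT (by simpa using fun h0 => hne (by simp [h0])))
    conv_lhs => rw [hspec]
    conv_rhs => rw [hspec]
    rw [Matrix.mul_assoc O D, ← Matrix.mul_assoc _ O, Matrix.mul_assoc _ Oᴴ O, hO,
      Matrix.mul_one, ← Matrix.mul_assoc, Matrix.mul_assoc O, hdiag]

end

/-! ### The lifted constraints and objective as linear functionals -/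

section Blocks
variable {ι : Type*} [Fintype ι]

theorem block00_tmul (z w : BaseSpace ι) : block00 (z ⊗ₜ[ℝ] w) = comp0 z * comp0 w := rfl

theorem block0_tmul (q : BaseSpace ι →ₗ[ℝ] Matrix ι ι ℝ) (z w : BaseSpace ι) :
    block0 q (z ⊗ₜ[ℝ] w) = comp0 z • q w := rfl

theorem block_tmul (p q : BaseSpace ι →ₗ[ℝ] Matrix ι ι ℝ) (z w : BaseSpace ι) :
    block p q (z ⊗ₜ[ℝ] w) = p z ⊗ₖ q w := rfl

variable [DecidableEq ι]

/-- The left-hand sides of the affine equations. -/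
def equationForm :
    (Fin 3 ⊕ ι × ι) ⊕ ι × ι → BaseSpace ι ⊗[ℝ] BaseSpace ι →ₗ[ℝ] ℝ
  | .inl (.inl k) => ![block00, Matrix.traceLinearMap ι ℝ ℝ ∘ₗ block0 comp2,
      Matrix.traceLinearMap (ι × ι) ℝ ℝ ∘ₗ block comp2 comp2] k
  | .inl (.inr ij) => frobInnerLeft (stdBasis ij.1 ij.2) ∘ₗ (block0 comp2 + block0 comp3)
  | .inr ij => frobInnerLeft (stdBasis ij.1 ij.2 ⊗ₖ stdBasis ij.1 ij.2) ∘ₗ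
      (block comp2 comp2 + block comp2 comp3 + block comp3 comp2 + block comp3 comp3)

/-- The right-hand sides of the affine equations. -/
def equationValue (ι : Type*) [DecidableEq ι] (r : ℕ) : (Fin 3 ⊕ ι × ι) ⊕ ι × ι → ℝ
  | .inl (.inl k) => ![1, (r : ℝ), (r : ℝ) ^ 2] k
  | .inl (.inr ij) => if ij.1 = ij.2 then 1 else 0
  | .inr ij => if ij.1 = ij.2 then 1 else 0

/-- The left-hand side of the complementarity inequality. -/
def complementarityForm (ι : Type*) [Fintype ι] [DecidableEq ι] :
    BaseSpace ι ⊗[ℝ] BaseSpace ι →ₗ[ℝ] ℝ :=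
  Matrix.traceLinearMap ι ℝ ℝ ∘ₗ block0 comp1 -
    frobInnerLeft (diagContraction ι) ∘ₗ block comp1 comp2

theorem linearConstraints_iff (r : ℕ) (𝒲 : BaseSpace ι ⊗[ℝ] BaseSpace ι) :
    LinearConstraints r 𝒲 ↔
      (∀ i, equationForm i 𝒲 = equationValue ι r i) ∧ complementarityForm ι 𝒲 ≤ 0 := by
  constructor
  · intro h
    refine ⟨?_, h.complementarity⟩
    rintro ((k | ij) | ij)
    · fin_cases k
      exacts [h.corner, h.trace_one, h.trace_two]
    · exact h.sum_one _ _
    · exact h.sum_two _ _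
  · rintro ⟨h, h'⟩
    exact ⟨h (.inl (.inl 0)), h (.inl (.inl 1)), h (.inl (.inl 2)),
      fun i j => h (.inl (.inr (i, j))), fun i j => h (.inr (i, j)), h'⟩

theorem convex_liftedFeasible (r : ℕ) : Convex ℝ (liftedFeasible ι r) := by
  refine Convex.inter ?_ (convex_convexHull ℝ _)
  intro x hx y hy a b ha hb hab
  rw [Set.mem_ofPred_eq, linearConstraints_iff] at *
  refine ⟨fun i => ?_, ?_⟩
  · rw [map_add, map_smul, map_smul, hx.1, hy.1, ← add_smul, hab, one_smul]
  · rw [map_add, map_smul, map_smul]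
    exact add_nonpos (mul_nonpos_of_nonneg_of_nonpos ha hx.2)
      (mul_nonpos_of_nonneg_of_nonpos hb hy.2)

end Blocks

/-- The linear part of the lifted objective. -/
def objectiveForm {p q n : ℕ} (X : Matrix (Fin q) (Fin n) ℝ) (Y : Matrix (Fin p) (Fin n) ℝ) :
    BaseSpace (Fin p ⊕ Fin q) ⊗[ℝ] BaseSpace (Fin p ⊕ Fin q) →ₗ[ℝ] ℝ :=
  (1 / (2 * (n : ℝ))) •
    (frobInnerLeft (reshuffle
        ((selV p q * X * Xᵀ * (selV p q)ᵀ) ⊗ₖ (selU p q * (selU p q)ᵀ))) ∘ₗ block comp1 comp1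
      - (2 : ℝ) • frobInnerLeft (selU p q * Y * Xᵀ * (selV p q)ᵀ) ∘ₗ block0 comp1)

theorem liftedObjective_eq {p q n : ℕ} (X : Matrix (Fin q) (Fin n) ℝ)
    (Y : Matrix (Fin p) (Fin n) ℝ)
    (𝒲 : BaseSpace (Fin p ⊕ Fin q) ⊗[ℝ] BaseSpace (Fin p ⊕ Fin q)) :
    liftedObjective X Y 𝒲 = objectiveForm X Y 𝒲 + 1 / (2 * (n : ℝ)) * frobSq Y := by
  rw [liftedObjective, mul_add]
  rfl

/-! ### The homogenized objective -/

theorem comp1_transpose {ι : Type*} [Fintype ι] (z : BaseSpace ι) : (comp1 z)ᵀ = comp1 z :=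
  (Matrix.conjTranspose_eq_transpose_of_trivial _).symm.trans z.2.1.2

/-- The residual of the off-diagonal block of `ω₁`, homogenized in `ω₀`. -/
def residual {p q n : ℕ} (X : Matrix (Fin q) (Fin n) ℝ) (Y : Matrix (Fin p) (Fin n) ℝ)
    (z : BaseSpace (Fin p ⊕ Fin q)) : Matrix (Fin p) (Fin n) ℝ :=
  (selU p q)ᵀ * comp1 z * selV p q * X - comp0 z • Y

theorem objectiveForm_tmul_self {p q n : ℕ} (X : Matrix (Fin q) (Fin n) ℝ)
    (Y : Matrix (Fin p) (Fin n) ℝ) (z : BaseSpace (Fin p ⊕ Fin q)) :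
    objectiveForm X Y (z ⊗ₜ[ℝ] z) + 1 / (2 * (n : ℝ)) * (comp0 z ^ 2 * frobSq Y) =
      1 / (2 * (n : ℝ)) * frobSq (residual X Y z) := by
  rw [residual, ← lifted_quadratic_eq X Y _ (comp1_transpose z), mul_add]
  rfl

/-! ### Scalar consequences of the affine constraints -/

section Rays
variable {ι : Type*} [Fintype ι]

theorem trace_kronecker_self (A : Matrix ι ι ℝ) : (A ⊗ₖ A).trace = A.trace ^ 2 := by
  rw [Matrix.trace_kronecker, sq]

variable [DecidableEq ι]

theorem frobInner_stdBasis_kronecker_add (V S : Matrix ι ι ℝ) (i j : ι) :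
    frobInner (stdBasis i j ⊗ₖ stdBasis i j) (V ⊗ₖ V + V ⊗ₖ S + S ⊗ₖ V + S ⊗ₖ S)
      = (V + S) i j ^ 2 := by
  rw [frobInner_stdBasis_kronecker]
  simp only [Matrix.add_apply, Matrix.kroneckerMap_apply]
  ring

/-- The scalar equations that the affine constraints force on every term `z ⊗ z` of positive
weight: `tr ω₂ = r ω₀`, `ω₂ + ω₃ = ω₀ I` and `⟨ω₁, ω₃⟩ = 0`. -/
structure IsComplementary (r : ℕ) (z : BaseSpace ι) : Prop where
  trace : (comp2 z).trace = r * comp0 z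
  sum : comp2 z + comp3 z = comp0 z • (1 : Matrix ι ι ℝ)
  inner : frobInner (comp1 z) (comp3 z) = 0

theorem IsComplementary.linearConstraints {r : ℕ} {z : BaseSpace ι} (hz : IsComplementary r z)
    (h1 : comp0 z = 1) : LinearConstraints r (z ⊗ₜ[ℝ] z) := by
  have hsum := hz.sum
  have htrace := hz.trace
  rw [h1, one_smul] at hsum
  rw [h1, mul_one] at htrace
  have h2 : comp2 z = 1 - comp3 z := eq_sub_of_add_eq hsum
  constructor
  · rw [block00_tmul, h1, mul_one]
  · rw [block0_tmul, h1, one_smul, htrace]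
  · rw [block_tmul, trace_kronecker_self, htrace]
  · intro i j
    rw [block0_tmul, block0_tmul, h1, one_smul, one_smul, hsum, frobInner_stdBasis,
      Matrix.one_apply]
  · intro i j
    simp only [block_tmul]
    rw [frobInner_stdBasis_kronecker_add, hsum, Matrix.one_apply]
    split_ifs <;> norm_num
  · rw [block0_tmul, block_tmul, frobInner_diagContraction, h1, one_smul, h2,
      ← frobInnerLeft_apply, map_sub, frobInnerLeft_apply, frobInnerLeft_apply, hz.inner,
      frobInner_eq_trace, Matrix.mul_one, Matrix.trace_transpose]
    simp

/-- The equality case of the Cauchy–Schwarz inequality for the weights `w`, with `a` of unit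
length: `x` is `c` times `a` wherever the weight is nonzero. -/
theorem eq_mul_of_weighted_sums {κ : Type*} {s : Finset κ} {w x a : κ → ℝ} {c : ℝ}
    (hw : ∀ i ∈ s, 0 ≤ w i) (h0 : ∑ i ∈ s, w i * (a i * a i) = 1)
    (h1 : ∑ i ∈ s, w i * (a i * x i) = c) (h2 : ∑ i ∈ s, w i * x i ^ 2 = c ^ 2)
    {i : κ} (hi : i ∈ s) (hwi : w i ≠ 0) : x i = c * a i := by
  have hsum : ∑ i ∈ s, w i * (x i - c * a i) ^ 2 = 0 := by
    calc ∑ i ∈ s, w i * (x i - c * a i) ^ 2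
        = ∑ i ∈ s, w i * x i ^ 2 - 2 * c * ∑ i ∈ s, w i * (a i * x i)
            + c ^ 2 * ∑ i ∈ s, w i * (a i * a i) := by
          rw [Finset.mul_sum, Finset.mul_sum, ← Finset.sum_sub_distrib, ← Finset.sum_add_distrib]
          exact Finset.sum_congr rfl fun i _ => by ring
      _ = 0 := by rw [h0, h1, h2]; ring
  have h := (Finset.sum_eq_zero_iff_of_nonneg fun i hi =>
    mul_nonneg (hw i hi) (sq_nonneg _)).1 hsum i hi
  exact sub_eq_zero.1 (pow_eq_zero_iff two_ne_zero |>.1 ((mul_eq_zero.1 h).resolve_left hwi))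

/-- The terms of a decomposition of a feasible point satisfy the scalar equations one by one:
each pair of a linear and a quadratic constraint is an equality case of Cauchy–Schwarz, and the
complementarity inequality bounds a sum of the nonnegative numbers `⟨ω₁, ω₃⟩`. -/
theorem isComplementary_of_linearConstraints {κ : Type*} {s : Finset κ} {w : κ → ℝ}
    {z : κ → BaseSpace ι} {r : ℕ} (hw : ∀ i ∈ s, 0 ≤ w i) (hz : ∀ i ∈ s, z i ∈ baseCone ι)
    (h : LinearConstraints r (∑ i ∈ s, w i • (z i ⊗ₜ[ℝ] z i))) {i : κ} (hi : i ∈ s)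
    (hwi : w i ≠ 0) : IsComplementary r (z i) := by
  have expand : ∀ f : BaseSpace ι ⊗[ℝ] BaseSpace ι →ₗ[ℝ] ℝ,
      f (∑ i ∈ s, w i • (z i ⊗ₜ[ℝ] z i)) = ∑ i ∈ s, w i * f (z i ⊗ₜ[ℝ] z i) := fun f => by
    simp only [map_sum, map_smul, smul_eq_mul]
  obtain ⟨heq, hle⟩ := (linearConstraints_iff r _).1 h
  simp only [expand] at heq hle
  have h0 : ∑ i ∈ s, w i * (comp0 (z i) * comp0 (z i)) = 1 := heq (.inl (.inl 0))
  have htrace : ∀ i ∈ s, w i ≠ 0 → (comp2 (z i)).trace = r * comp0 (z i) := by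
    intro i hi hwi
    refine eq_mul_of_weighted_sums (a := fun i => comp0 (z i))
      (x := fun i => (comp2 (z i)).trace) hw h0 ?_ ?_ hi hwi
    · refine Eq.trans (Finset.sum_congr rfl fun i _ => ?_) (heq (.inl (.inl 1)))
      change _ = w i * (comp0 (z i) • comp2 (z i)).trace
      rw [Matrix.trace_smul, smul_eq_mul]
    · refine Eq.trans (Finset.sum_congr rfl fun i _ => ?_) (heq (.inl (.inl 2)))
      rw [← trace_kronecker_self]
      rfl
  have hsum : ∀ i ∈ s, w i ≠ 0 → comp2 (z i) + comp3 (z i) = comp0 (z i) • (1 : Matrix ι ι ℝ) := by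
    intro i hi hwi
    ext j k
    have hjk : (comp2 (z i) + comp3 (z i)) j k = (if j = k then 1 else 0) * comp0 (z i) := by
      refine eq_mul_of_weighted_sums (a := fun i => comp0 (z i))
        (x := fun i => (comp2 (z i) + comp3 (z i)) j k) hw h0 ?_ ?_ hi hwi
      · refine Eq.trans (Finset.sum_congr rfl fun i _ => ?_) (heq (.inl (.inr (j, k))))
        change _ = w i * frobInner (stdBasis j k)
          (comp0 (z i) • comp2 (z i) + comp0 (z i) • comp3 (z i))
        rw [← smul_add, frobInner_stdBasis, Matrix.smul_apply, smul_eq_mul]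
      · refine Eq.trans (Finset.sum_congr rfl fun i _ => ?_)
          ((heq (.inr (j, k))).trans (?_ : (if j = k then (1 : ℝ) else 0) = _))
        · rw [← frobInner_stdBasis_kronecker_add]
          rfl
        · split_ifs <;> norm_num
    rw [hjk, Matrix.smul_apply, Matrix.one_apply, smul_eq_mul, mul_comm]
  refine ⟨htrace i hi hwi, hsum i hi hwi, ?_⟩
  have hnonneg : ∀ i ∈ s, 0 ≤ w i * frobInner (comp1 (z i)) (comp3 (z i)) := fun i hi =>
    mul_nonneg (hw i hi) (frobInner_nonneg_and_mul_eq_zero (hz i hi).2.1 (hz i hi).2.2.2).1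
  have hle' : ∑ i ∈ s, w i * frobInner (comp1 (z i)) (comp3 (z i)) ≤ 0 := by
    refine (Finset.sum_congr rfl fun i hi => ?_).trans_le hle
    by_cases hwi : w i = 0
    · rw [hwi, zero_mul, zero_mul]
    change _ = w i * ((comp0 (z i) • comp1 (z i)).trace -
      frobInner (diagContraction ι) (comp1 (z i) ⊗ₖ comp2 (z i)))
    -- with `ω₂ = ω₀ I - ω₃`, the term is `ω₀ tr ω₁ - ⟨ω₁, ω₀ I - ω₃⟩ = ⟨ω₁, ω₃⟩`
    rw [frobInner_diagContraction, eq_sub_of_add_eq (hsum i hi hwi),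
      ← frobInnerLeft_apply _ (_ - _),
      map_sub, map_smul, frobInnerLeft_apply, frobInnerLeft_apply, frobInner_eq_trace _ 1,
      Matrix.mul_one, Matrix.trace_transpose, Matrix.trace_smul, sub_sub_cancel]
  have hzero := (Finset.sum_eq_zero_iff_of_nonneg hnonneg).1
    (le_antisymm hle' (Finset.sum_nonneg hnonneg)) i hi
  exact (mul_eq_zero.1 hzero).resolve_left hwi

/-- Since `ω₁ * ω₃ = 0`, the matrix `ω₁` is supported on the fixed space of `ω₂ / ω₀`, which has
dimension at most `tr ω₂ / ω₀ = r`. -/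
theorem IsComplementary.rank_le {r : ℕ} {z : BaseSpace ι} (hz : IsComplementary r z)
    (hcone : z ∈ baseCone ι) (h0 : comp0 z ≠ 0) : (comp1 z).rank ≤ r := by
  obtain ⟨ha, hU, hV, hS⟩ := hcone
  have hinv : 0 ≤ (comp0 z)⁻¹ := inv_nonneg.2 ha
  refine rank_le_of_mul_eq_zero (hV.smul hinv) (hS.smul hinv) ?_ ?_
    (?_ : comp1 z * ((comp0 z)⁻¹ • comp3 z) = 0)
  · change (comp0 z)⁻¹ • comp2 z + (comp0 z)⁻¹ • comp3 z = 1
    rw [← smul_add, hz.sum, smul_smul, inv_mul_cancel₀ h0, one_smul]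
  · change ((comp0 z)⁻¹ • comp2 z).trace = r
    rw [Matrix.trace_smul, hz.trace, smul_eq_mul]
    field_simp
  · have hzero : comp1 z * comp3 z = 0 := (frobInner_nonneg_and_mul_eq_zero hU hS).2 hz.inner
    rw [Matrix.mul_smul, hzero, smul_zero]

end Rays

/-! ### Comparison of the two objectives -/

theorem exists_sum_of_mem_cpCone {V : Type*} [AddCommGroup V] [Module ℝ V] {K : Set V}
    {x : V ⊗[ℝ] V} (hx : x ∈ cpCone K) :
    ∃ (κ : Type) (s : Finset κ) (w : κ → ℝ) (z : κ → V), (∀ i ∈ s, 0 ≤ w i) ∧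
      (∀ i ∈ s, z i ∈ K) ∧ x = ∑ i ∈ s, w i • (z i ⊗ₜ[ℝ] z i) := by
  have h := (Set.ext_iff.1 (convexHull_eq (R := ℝ) ((fun z : V => z ⊗ₜ[ℝ] z) '' K)) x).1 hx
  obtain ⟨κ, s, w, y, hw, hw1, hy, rfl⟩ := h
  choose! z hz hzy using hy
  refine ⟨κ, s, w, z, hw, hz, ?_⟩
  rw [Finset.centerMass_eq_of_sum_1 _ _ hw1]
  exact Finset.sum_congr rfl fun i hi => congrArg (w i • ·) (hzy i hi).symm

/-- Homogeneity reduces a term with `ω₀ > 0` to a residual of rank at most `r`; a term with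
`ω₀ = 0` is a recession direction, along which the objective cannot decrease. -/
theorem IsComplementary.mul_le_frobSq_residual {p q n r : ℕ} {X : Matrix (Fin q) (Fin n) ℝ}
    {Y : Matrix (Fin p) (Fin n) ℝ} {m : ℝ}
    (hm : ∀ Z : Matrix (Fin p) (Fin q) ℝ, Z.rank ≤ r → m ≤ frobSq (Z * X - Y))
    {z : BaseSpace (Fin p ⊕ Fin q)} (hz : IsComplementary r z)
    (hcone : z ∈ baseCone (Fin p ⊕ Fin q)) :
    comp0 z ^ 2 * m ≤ frobSq (residual X Y z) := by
  by_cases h0 : comp0 z = 0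
  · rw [h0, zero_pow two_ne_zero, zero_mul]
    exact frobSq_nonneg _
  set Z := (selU p q)ᵀ * comp1 z * selV p q with hZ
  have hrank : ((comp0 z)⁻¹ • Z).rank ≤ r := by
    have hfac : (comp0 z)⁻¹ • Z = (selU p q)ᵀ * (comp1 z * ((comp0 z)⁻¹ • selV p q)) := by
      rw [hZ, Matrix.mul_smul, Matrix.mul_smul, Matrix.mul_assoc]
    rw [hfac]
    exact ((Matrix.rank_mul_le_right _ _).trans (Matrix.rank_mul_le_left _ _)).trans
      (hz.rank_le hcone h0)
  have hres : residual X Y z = comp0 z • (((comp0 z)⁻¹ • Z) * X - Y) := by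
    rw [residual, smul_sub, Matrix.smul_mul, smul_smul, mul_inv_cancel₀ h0, one_smul]
  rw [hres, frobSq_smul]
  exact mul_le_mul_of_nonneg_left (hm _ hrank) (sq_nonneg _)

theorem le_liftedObjective {p q n r : ℕ} {X : Matrix (Fin q) (Fin n) ℝ}
    {Y : Matrix (Fin p) (Fin n) ℝ} {m : ℝ}
    (hm : ∀ Z : Matrix (Fin p) (Fin q) ℝ, Z.rank ≤ r → m ≤ frobSq (Z * X - Y))
    {𝒲 : BaseSpace (Fin p ⊕ Fin q) ⊗[ℝ] BaseSpace (Fin p ⊕ Fin q)}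
    (h𝒲 : 𝒲 ∈ liftedFeasible (Fin p ⊕ Fin q) r) :
    1 / (2 * (n : ℝ)) * m ≤ liftedObjective X Y 𝒲 := by
  obtain ⟨hlin, hcp⟩ := h𝒲
  obtain ⟨κ, s, w, z, hw, hz, rfl⟩ := exists_sum_of_mem_cpCone hcp
  have h0 : ∑ i ∈ s, w i * comp0 (z i) ^ 2 = 1 := by
    have := hlin.corner
    simpa only [map_sum, map_smul, smul_eq_mul, block00_tmul, ← sq] using this
  have hc : 0 ≤ 1 / (2 * (n : ℝ)) := by positivity
  calc 1 / (2 * (n : ℝ)) * m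
      = ∑ i ∈ s, w i * (1 / (2 * (n : ℝ)) * (comp0 (z i) ^ 2 * m)) := by
        rw [← one_mul (1 / (2 * (n : ℝ)) * m), ← h0, Finset.sum_mul]
        exact Finset.sum_congr rfl fun i _ => by ring
    _ ≤ ∑ i ∈ s, w i * (1 / (2 * (n : ℝ)) * frobSq (residual X Y (z i))) := by
        refine Finset.sum_le_sum fun i hi => ?_
        by_cases hwi : w i = 0
        · rw [hwi, zero_mul, zero_mul]
        · exact mul_le_mul_of_nonneg_left (mul_le_mul_of_nonneg_left
            ((isComplementary_of_linearConstraints hw hz hlin hi hwi).mul_le_frobSq_residual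
              hm (hz i hi)) hc) (hw i hi)
    _ = liftedObjective X Y (∑ i ∈ s, w i • (z i ⊗ₜ[ℝ] z i)) := by
        have hY : 1 / (2 * (n : ℝ)) * frobSq Y
            = 1 / (2 * (n : ℝ)) * frobSq Y * ∑ i ∈ s, w i * comp0 (z i) ^ 2 := by
          rw [h0, mul_one]
        rw [liftedObjective_eq, map_sum, hY, Finset.mul_sum, ← Finset.sum_add_distrib]
        refine Finset.sum_congr rfl fun i _ => ?_
        rw [← objectiveForm_tmul_self, map_smul, smul_eq_mul]
        ring

/-- A factorization `Z = A * B` through `r` coordinates gives `F = [A; Bᵀ]`, whose Gram matrix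
`F * Fᵀ` has off-diagonal block `Z`. Together with a projection of rank `r` fixing the range of
`F`, it is a feasible rank-one point with the loss of `Z` as objective value. -/
theorem exists_liftedFeasible_of_rank_le {p q n r : ℕ} (X : Matrix (Fin q) (Fin n) ℝ)
    (Y : Matrix (Fin p) (Fin n) ℝ) {Z : Matrix (Fin p) (Fin q) ℝ} (hZ : Z.rank ≤ r)
    (hr : r ≤ p + q) :
    ∃ 𝒲 ∈ liftedFeasible (Fin p ⊕ Fin q) r,
      liftedObjective X Y 𝒲 = 1 / (2 * (n : ℝ)) * frobSq (Z * X - Y) := by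
  obtain ⟨A, B, rfl⟩ := exists_eq_mul_of_rank_le Z hZ
  let F : Matrix (Fin p ⊕ Fin q) (Fin r) ℝ := Matrix.fromRows A Bᵀ
  have hU : (F * Fᴴ).PosSemidef := Matrix.posSemidef_self_mul_conjTranspose F
  obtain ⟨V, hV, hS, hVr, hUV⟩ := exists_projection_of_rank_le hU.1 (r := r)
    ((Matrix.rank_mul_le_left _ _).trans (F.rank_le_card_width.trans_eq (Fintype.card_fin r)))
    (by simpa using hr)
  let z : BaseSpace (Fin p ⊕ Fin q) := (1, ⟨F * Fᴴ, hU.1⟩, ⟨V, hV.1⟩, ⟨1 - V, hS.1⟩)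
  have h1 : comp0 z = 1 := rfl
  have hcomp : IsComplementary r z := by
    refine ⟨?_, ?_, ?_⟩
    · rw [h1, mul_one]
      exact hVr
    · rw [h1, one_smul]
      exact add_sub_cancel V 1
    · change frobInner (F * Fᴴ) (1 - V) = 0
      rw [frobInner_eq_trace, ← Matrix.conjTranspose_eq_transpose_of_trivial, hU.1.eq,
        Matrix.mul_sub, Matrix.mul_one, hUV, sub_self, Matrix.trace_zero]
  refine ⟨z ⊗ₜ[ℝ] z, ⟨hcomp.linearConstraints h1,
    subset_convexHull ℝ _ ⟨z, ⟨zero_le_one, hU, hV, hS⟩, rfl⟩⟩, ?_⟩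
  have hobj := objectiveForm_tmul_self X Y z
  rw [h1, one_pow, one_mul, ← liftedObjective_eq] at hobj
  rw [hobj, residual, h1, one_smul]
  have hblock : (selU p q)ᵀ * comp1 z * selV p q = A * B := by
    change (selU p q)ᵀ * (F * Fᴴ) * selV p q = A * B
    rw [← Matrix.mul_assoc, Matrix.mul_assoc, Matrix.conjTranspose_eq_transpose_of_trivial]
    congr 1
    · simp [F, selU, Matrix.transpose_fromRows, Matrix.fromCols_mul_fromRows]
    · simp [F, selV, Matrix.transpose_fromRows, Matrix.fromCols_mul_fromRows]
  rw [hblock]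

end DeepLinearCP

end

open DeepLinearCP in
theorem theorem2 (N : ℕ) (hN : 1 ≤ N) (d : Fin (N + 1) → ℕ) (n : ℕ) (hn : 1 ≤ n)
    (X : Matrix (Fin (d 0)) (Fin n) ℝ) (Y : Matrix (Fin (d (Fin.last N))) (Fin n) ℝ) :
    -- both minima are attained and they are equal
    (∃ v : ℝ,
      IsLeast (Set.range (deepLoss d X Y)) v ∧
      IsLeast (liftedObjective X Y ''
        liftedFeasible (Fin (d (Fin.last N)) ⊕ Fin (d 0)) (minWidth d)) v) ∧
    -- the lifted program is convex
    Convex ℝ (liftedFeasible (Fin (d (Fin.last N)) ⊕ Fin (d 0)) (minWidth d)) ∧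
    -- apart from the cone constraint, it is linear in the lifted variable
    (∃ (L : BaseSpace (Fin (d (Fin.last N)) ⊕ Fin (d 0)) ⊗[ℝ]
          BaseSpace (Fin (d (Fin.last N)) ⊕ Fin (d 0)) →ₗ[ℝ] ℝ) (c : ℝ),
        ∀ 𝒲, liftedObjective X Y 𝒲 = L 𝒲 + c) ∧
    (∃ (m : ℕ)
        (a : Fin m → BaseSpace (Fin (d (Fin.last N)) ⊕ Fin (d 0)) ⊗[ℝ]
          BaseSpace (Fin (d (Fin.last N)) ⊕ Fin (d 0)) →ₗ[ℝ] ℝ) (b : Fin m → ℝ)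
        (g : BaseSpace (Fin (d (Fin.last N)) ⊕ Fin (d 0)) ⊗[ℝ]
          BaseSpace (Fin (d (Fin.last N)) ⊕ Fin (d 0)) →ₗ[ℝ] ℝ),
        ∀ 𝒲, LinearConstraints (minWidth d) 𝒲 ↔ (∀ i, a i 𝒲 = b i) ∧ g 𝒲 ≤ 0) ∧
    -- the contraction property of `Δ`
    (∀ A B : Matrix (Fin (d (Fin.last N)) ⊕ Fin (d 0)) (Fin (d (Fin.last N)) ⊕ Fin (d 0)) ℝ,
      frobInner (diagContraction (Fin (d (Fin.last N)) ⊕ Fin (d 0))) (A ⊗ₖ B)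
        = frobInner A B) := by
  have hlast : minWidth d ≤ d (Fin.last N) := Finset.inf'_le _ (Finset.mem_univ _)
  refine ⟨?_, convex_liftedFeasible _, ⟨objectiveForm X Y, _, liftedObjective_eq X Y⟩, ?_,
    frobInner_diagContraction⟩
  · obtain ⟨Z₀, hZ₀, hmin⟩ := exists_isMinOn_rank_le (r := minWidth d) X Y
    have hc : 0 ≤ 1 / (2 * (n : ℝ)) := by positivity
    refine ⟨1 / (2 * (n : ℝ)) * frobSq (Z₀ * X - Y), ⟨?_, ?_⟩, ?_, ?_⟩
    · obtain ⟨W, rfl⟩ : Z₀ ∈ Set.range (layerProd d) := by rwa [range_layerProd hN]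
      exact ⟨W, rfl⟩
    · rintro _ ⟨W, rfl⟩
      have hW : layerProd d W ∈ Set.range (layerProd d) := ⟨W, rfl⟩
      rw [range_layerProd hN] at hW
      exact mul_le_mul_of_nonneg_left (hmin _ hW) hc
    · exact exists_liftedFeasible_of_rank_le X Y hZ₀ (hlast.trans (Nat.le_add_right _ _))
    · rintro _ ⟨𝒲, h𝒲, rfl⟩
      exact le_liftedObjective hmin h𝒲
  · let e := Fintype.equivFin ((Fin 3 ⊕ (Fin (d (Fin.last N)) ⊕ Fin (d 0)) ×
      (Fin (d (Fin.last N)) ⊕ Fin (d 0))) ⊕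
      (Fin (d (Fin.last N)) ⊕ Fin (d 0)) × (Fin (d (Fin.last N)) ⊕ Fin (d 0)))
    refine ⟨_, fun k => equationForm (e.symm k), fun k => equationValue _ (minWidth d) (e.symm k),
      complementarityForm _, fun 𝒲 => ?_⟩
    rw [linearConstraints_iff, e.symm.forall_congr_right
      (q := fun i => equationForm i 𝒲 = equationValue _ (minWidth d) i)]
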